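/- **Setting.** Let $A\subset C$ and $B\subset D$ be unital inclusions of unital $C^*$-algebras (closed $*$-subalgebras containing the unit) which are strongly Morita equivalent with respect to a $C$-$D$-equivalence bimodule $Y$ and its closed subspace $X$. That is, $Y$ is a full left Hilbert $C$-module with inner product ${}_C\langle\cdot,\cdot\rangle$ (linear in the first variable) and a full right Hilbert $D$-module with inner product $\langle\cdot,\cdot\rangle_D$ (linear in the second variable), both inducing the same complete norm, the two actions commute, and $${}_C\langle x\cdot d,y\rangle={}_C\langle x,y\cdot d^*\rangle,\qquad \langle c\cdot x,y\rangle_D=\langle x,c^*\cdot y\rangle_D,\qquad {}_C\langle x,y\rangle\cdot z=x\cdot\langle y,z\rangle_D$$ for all $x,y,z\in Y$, $c\in C$, $d\in D$; and $X\subset Y$ is a closed linear subspace such that 1. $a\cdot x\in X$ and ${}_C\langle x,y\rangle\in A$ for all $a\in A$, $x,y\in X$, and the closed linear spans of ${}_C\langle X,X\rangle$ and ${}_C\langle Y,X\rangle$ are $A$ and $C$, respectively; 2. $x\cdot b\in X$ and $\langle x,y\rangle_D\in B$ for all $b\in B$, $x,y\in X$, and the closed linear spans of $\langle X,X\rangle_D$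 and $\langle Y,X\rangle_D$ are $B$ and $D$, respectively. Let ${}_A\mathbf B_A(C,A)$ (resp. ${}_B\mathbf B_B(D,B)$) be the space of bounded linear $A$-bimodule maps $C\to A$ (resp. $B$-bimodule maps $D\to B$). For each $\phi\in{}_A\mathbf B_A(C,A)$ there are a unique linear map $\tau:Y\to X$ and a unique $\psi\in{}_B\mathbf B_B(D,B)$ such that, for all $a\in A$, $b\in B$, $c\in C$, $d\in D$, $x\in X$, $y\in Y$, $$\tau(c\cdot x)=\phi(c)\cdot x,\quad \tau(a\cdot y)=a\cdot\tau(y),\quad {}_C\langle\tau(y),x\rangle=\phi({}_C\langle y,x\rangle),$$ $$\tau(x\cdot d)=x\cdot\psi(d),\quad \tau(y\cdot b)=\tau(y)\cdot b,\quad \psi(\langle x,y\rangle_D)=\langle x,\tau(y)\rangle_D .$$ Put $f(\phi)=\psi$. An element $\phi\in{}_A\mathbf B_A(C,A)$ is a *conditional expectation* from $C$ onto $A$ if it is positive and $\phi(a)=a$ for all $a\in A$. It is of *Watatani index-finite type* if it has a quasi-basis, i.e. there are finitely many pairs $(u_i,v_i)\in C\times C$, $1\le i\le m$, with $$c=\sum_{i=1}^m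 u_i\,\phi(v_i c)=\sum_{i=1}^m \phi(c u_i)\,v_i\qquad\text{for all } c\in C.$$ The same terms are used for $B\subset D$. **Corollary.** If $E^A$ is a conditional expectation from $C$ onto $A$ of Watatani index-finite type, then $f(E^A)$ is a conditional expectation from $D$ onto $B$ of Watatani index-finite type. -/

import Mathlib

namespace InclusionMorita

open MulOpposite

/-- A `C`-`D`-equivalence bimodule `Y` (also called an imprimitivity bimodule): a Banach space with
commuting left `C`-action and right `D`-action (written as a left action of `Dᵐᵒᵖ`, so that
`y · d` is `op d • y`), which is a full left Hilbert `C`-module for `leftInner` and a full right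
Hilbert `D`-module for `rightInner`, such that each algebra acts by adjointable operators for the
other inner product and `⟨x, y⟩_C · z = x · ⟨y, z⟩_D`.
The left inner product is linear in its first variable, the right one in its second. -/
structure EquivalenceBimodule (C D Y : Type*)
    [CStarAlgebra C] [PartialOrder C] [StarOrderedRing C]
    [CStarAlgebra D] [PartialOrder D] [StarOrderedRing D]
    [NormedAddCommGroup Y] [NormedSpace ℂ Y] [CompleteSpace Y]
    [Module C Y] [Module Dᵐᵒᵖ Y] where
  /-- the `C`-valued inner product -/
  leftInner : Y → Y → C
  /-- the `D`-valued inner product -/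
  rightInner : Y → Y → D
  smul_assoc_left (t : ℂ) (c : C) (y : Y) : (t • c) • y = t • (c • y)
  smul_assoc_right (t : ℂ) (d : D) (y : Y) : op (t • d) • y = t • (op d • y)
  smul_comm (c : C) (d : D) (y : Y) : c • (op d • y) = op d • (c • y)
  leftInner_add_left (x y z : Y) : leftInner (x + y) z = leftInner x z + leftInner y z
  leftInner_smul_left (c : C) (x y : Y) : leftInner (c • x) y = c * leftInner x y
  star_leftInner (x y : Y) : star (leftInner x y) = leftInner y x
  leftInner_self_nonneg (x : Y) : 0 ≤ leftInner x x
  leftInner_self_eq_zero (x : Y) : leftInner x x = 0 → x = 0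
  norm_sq_eq_leftInner (x : Y) : ‖x‖ ^ 2 = ‖leftInner x x‖
  rightInner_add_right (x y z : Y) : rightInner x (y + z) = rightInner x y + rightInner x z
  rightInner_smul_right (d : D) (x y : Y) : rightInner x (op d • y) = rightInner x y * d
  star_rightInner (x y : Y) : star (rightInner x y) = rightInner y x
  rightInner_self_nonneg (x : Y) : 0 ≤ rightInner x x
  rightInner_self_eq_zero (x : Y) : rightInner x x = 0 → x = 0
  norm_sq_eq_rightInner (x : Y) : ‖x‖ ^ 2 = ‖rightInner x x‖
  leftInner_op_smul (d : D) (x y : Y) : leftInner (op d • x) y = leftInner x (op (star d) • y)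
  rightInner_smul (c : C) (x y : Y) : rightInner (c • x) y = rightInner x (star c • y)
  leftInner_smul (x y z : Y) : leftInner x y • z = op (rightInner y z) • x
  left_full : closure (Submodule.span ℂ {c : C | ∃ x y, leftInner x y = c} : Set C) = Set.univ
  right_full : closure (Submodule.span ℂ {d : D | ∃ x y, rightInner x y = d} : Set D) = Set.univ

variable {C D Y : Type*}
  [CStarAlgebra C] [PartialOrder C] [StarOrderedRing C]
  [CStarAlgebra D] [PartialOrder D] [StarOrderedRing D]
  [NormedAddCommGroup Y] [NormedSpace ℂ Y] [CompleteSpace Y]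
  [Module C Y] [Module Dᵐᵒᵖ Y]

/-- The unital inclusions of unital C⋆-algebras `A ⊆ C` and `B ⊆ D` are strongly Morita equivalent
with respect to the `C`-`D`-equivalence bimodule `Y` (with structure `E`) and its closed
subspace `X`. -/
structure IsMoritaPair (A : StarSubalgebra ℂ C) (B : StarSubalgebra ℂ D)
    (E : EquivalenceBimodule C D Y) (X : Submodule ℂ Y) : Prop where
  isClosed_left : IsClosed (A : Set C)
  isClosed_right : IsClosed (B : Set D)
  isClosed_subspace : IsClosed (X : Set Y)
  smul_mem (a : C) (x : Y) : a ∈ A → x ∈ X → a • x ∈ X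
  leftInner_mem (x y : Y) : x ∈ X → y ∈ X → E.leftInner x y ∈ A
  closure_left : closure (Submodule.span ℂ
    {c : C | ∃ x ∈ X, ∃ y ∈ X, E.leftInner x y = c} : Set C) = A
  closure_left_top : closure (Submodule.span ℂ
    {c : C | ∃ y : Y, ∃ x ∈ X, E.leftInner y x = c} : Set C) = Set.univ
  op_smul_mem (b : D) (x : Y) : b ∈ B → x ∈ X → op b • x ∈ X
  rightInner_mem (x y : Y) : x ∈ X → y ∈ X → E.rightInner x y ∈ B
  closure_right : closure (Submodule.span ℂ
    {d : D | ∃ x ∈ X, ∃ y ∈ X, E.rightInner x y = d} : Set D) = B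
  closure_right_top : closure (Submodule.span ℂ
    {d : D | ∃ y : Y, ∃ x ∈ X, E.rightInner y x = d} : Set D) = Set.univ

/-- The space of bounded `A`-bimodule linear maps from `C` to `A`. -/
def BimoduleMaps {C : Type*} [CStarAlgebra C] (A : StarSubalgebra ℂ C) :
    Submodule ℂ (C →L[ℂ] A) where
  carrier := {φ | ∀ (a : A) (c : C), φ (a * c) = a * φ c ∧ φ (c * a) = φ c * a}
  add_mem' := by
    intro φ ψ hφ hψ a c
    simp [(hφ a c).1, (hφ a c).2, (hψ a c).1, (hψ a c).2, mul_add, add_mul]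
  zero_mem' := by intro a c; simp
  smul_mem' := by
    intro t φ hφ a c
    simp [(hφ a c).1, (hφ a c).2]

/-- A bounded `A`-bimodule map `φ : C → A` is a conditional expectation from `C` onto `A` if it is
positive and restricts to the identity on `A`. -/
def IsConditionalExpectation {C : Type*} [CStarAlgebra C] [PartialOrder C]
    {A : StarSubalgebra ℂ C} (φ : BimoduleMaps A) : Prop :=
  (∀ a : A, φ.1 (a : C) = a) ∧ ∀ c : C, 0 ≤ c → 0 ≤ (φ.1 c : C)

/-- The finite family `(u i, v i)` is a quasi-basis for `φ`. -/
def IsQuasiBasis {C : Type*} [CStarAlgebra C] {A : StarSubalgebra ℂ C} (φ : BimoduleMaps A)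
    {m : ℕ} (u v : Fin m → C) : Prop :=
  ∀ c : C, c = ∑ i, u i * (φ.1 (v i * c) : C) ∧ c = ∑ i, (φ.1 (c * u i) : C) * v i

/-- Watatani index-finite type: there is a quasi-basis. -/
def IsIndexFinite {C : Type*} [CStarAlgebra C] {A : StarSubalgebra ℂ C}
    (φ : BimoduleMaps A) : Prop :=
  ∃ (m : ℕ) (u v : Fin m → C), IsQuasiBasis φ u v

/-- The conditions tying a bimodule map `φ : C → A` to a linear map `τ : Y → X` and a bimodule map
`ψ : D → B`. -/
structure IsTransfer {A : StarSubalgebra ℂ C} {B : StarSubalgebra ℂ D}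
    (E : EquivalenceBimodule C D Y) {X : Submodule ℂ Y}
    (φ : BimoduleMaps A) (τ : Y →ₗ[ℂ] X) (ψ : BimoduleMaps B) : Prop where
  tau_smul (c : C) (x : X) : (τ (c • (x : Y)) : Y) = (φ.1 c : C) • (x : Y)
  tau_smul_left (a : A) (y : Y) : (τ ((a : C) • y) : Y) = (a : C) • (τ y : Y)
  leftInner_tau (y : Y) (x : X) : E.leftInner (τ y) x = φ.1 (E.leftInner y x)
  tau_op_smul (d : D) (x : X) : (τ (op d • (x : Y)) : Y) = op (ψ.1 d : D) • (x : Y)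
  tau_op_smul_right (b : B) (y : Y) : (τ (op (b : D) • y) : Y) = op (b : D) • (τ y : Y)
  psi_rightInner (x : X) (y : Y) : (ψ.1 (E.rightInner x y) : D) = E.rightInner x (τ y)

namespace EquivalenceBimodule

variable (E : EquivalenceBimodule C D Y)

theorem leftInner_smul_complex (t : ℂ) (x y : Y) :
    E.leftInner (t • x) y = t • E.leftInner x y := by
  have : t • x = (t • (1 : C)) • x := by rw [E.smul_assoc_left, one_smul]
  rw [this, E.leftInner_smul_left, smul_mul_assoc, one_mul]

theorem rightInner_smul_complex (t : ℂ) (x y : Y) :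
    E.rightInner x (t • y) = t • E.rightInner x y := by
  have : t • y = op (t • (1 : D)) • y := by rw [E.smul_assoc_right, op_one, one_smul]
  rw [this, E.rightInner_smul_right, mul_smul_comm, mul_one]

/-- The left inner product as a linear map in its first variable. -/
def leftInnerₗ (y : Y) : Y →ₗ[ℂ] C where
  toFun x := E.leftInner x y
  map_add' x z := E.leftInner_add_left x z y
  map_smul' t x := E.leftInner_smul_complex t x y

/-- The right inner product as a linear map in its second variable. -/
def rightInnerₗ (x : Y) : Y →ₗ[ℂ] D where
  toFun y := E.rightInner x y
  map_add' y z := E.rightInner_add_right x y z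
  map_smul' t y := E.rightInner_smul_complex t x y

theorem leftInner_sum {ι : Type*} (s : Finset ι) (x : ι → Y) (y : Y) :
    E.leftInner (∑ i ∈ s, x i) y = ∑ i ∈ s, E.leftInner (x i) y :=
  map_sum (E.leftInnerₗ y) x s

theorem leftInner_add_right (x y z : Y) :
    E.leftInner x (y + z) = E.leftInner x y + E.leftInner x z := by
  rw [← E.star_leftInner, E.leftInner_add_left, star_add, E.star_leftInner, E.star_leftInner]

theorem rightInner_add_left (x y z : Y) :
    E.rightInner (x + y) z = E.rightInner x z + E.rightInner y z := by
  rw [← E.star_rightInner, E.rightInner_add_right, star_add, E.star_rightInner,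
    E.star_rightInner]

theorem leftInner_smul_complex_right (t : ℂ) (x y : Y) :
    E.leftInner x (t • y) = star t • E.leftInner x y := by
  rw [← E.star_leftInner, E.leftInner_smul_complex, star_smul, E.star_leftInner]

theorem rightInner_smul_complex_left (t : ℂ) (x y : Y) :
    E.rightInner (t • x) y = star t • E.rightInner x y := by
  rw [← E.star_rightInner, E.rightInner_smul_complex, star_smul, E.star_rightInner]

theorem norm_le_of_polarization {V W : Type*} [NormedAddCommGroup V] [NormedSpace ℂ V]
    [NormedAddCommGroup W] [NormedSpace ℂ W] (g : V → W) (hg : ∀ v, ‖g v‖ = ‖v‖ ^ 2)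
    (x y : V) (w : W)
    (h : (4 : ℂ) • w = g (x + y) - g (x - y) + Complex.I • g (x + Complex.I • y)
      - Complex.I • g (x - Complex.I • y)) : ‖w‖ ≤ (‖x‖ + ‖y‖) ^ 2 := by
  have hI : ‖Complex.I • y‖ = ‖y‖ := by rw [norm_smul, Complex.norm_I, one_mul]
  have key : ∀ z : V, ‖z‖ ≤ ‖x‖ + ‖y‖ → ‖g z‖ ≤ (‖x‖ + ‖y‖) ^ 2 := by
    intro z hz
    rw [hg]
    gcongr
  have h1 := key (x + y) (norm_add_le _ _)
  have h2 := key (x - y) (norm_sub_le _ _)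
  have h3 := key (x + Complex.I • y) ((norm_add_le _ _).trans_eq (by rw [hI]))
  have h4 := key (x - Complex.I • y) ((norm_sub_le _ _).trans_eq (by rw [hI]))
  have h5 : ‖(4 : ℂ) • w‖ = 4 * ‖w‖ := by rw [norm_smul]; norm_num
  have h6 : ‖(4 : ℂ) • w‖ ≤ ‖g (x + y)‖ + ‖g (x - y)‖ + ‖g (x + Complex.I • y)‖
      + ‖g (x - Complex.I • y)‖ := by
    rw [h]
    refine (norm_sub_le _ _).trans ?_
    rw [norm_smul, Complex.norm_I, one_mul]
    gcongr
    refine (norm_add_le _ _).trans ?_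
    rw [norm_smul, Complex.norm_I, one_mul]
    gcongr
    exact norm_sub_le _ _
  linarith

theorem norm_leftInner_le (x y : Y) : ‖E.leftInner x y‖ ≤ (‖x‖ + ‖y‖) ^ 2 := by
  refine norm_le_of_polarization (fun v => E.leftInner v v)
    (fun v => (E.norm_sq_eq_leftInner v).symm) x y _ ?_
  simp only [sub_eq_add_neg, ← neg_one_smul ℂ (y), ← neg_one_smul ℂ (Complex.I • y),
    E.leftInner_add_left, E.leftInner_add_right,
    E.leftInner_smul_complex, E.leftInner_smul_complex_right]
  simp only [RCLike.star_def, Complex.conj_I, map_neg, map_one]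
  match_scalars <;> ring_nf <;> simp
  norm_num

theorem norm_rightInner_le (x y : Y) : ‖E.rightInner x y‖ ≤ (‖x‖ + ‖y‖) ^ 2 := by
  rw [← norm_star, E.star_rightInner]
  refine norm_le_of_polarization (fun v => E.rightInner v v)
    (fun v => (E.norm_sq_eq_rightInner v).symm) x y _ ?_
  simp only [sub_eq_add_neg, ← neg_one_smul ℂ (y), ← neg_one_smul ℂ (Complex.I • y),
    E.rightInner_add_right, E.rightInner_add_left,
    E.rightInner_smul_complex, E.rightInner_smul_complex_left]
  simp only [RCLike.star_def, Complex.conj_I, map_neg, map_one]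
  match_scalars <;> ring_nf <;> simp
  norm_num

theorem continuous_of_quadratic_bound {V W : Type*} [NormedAddCommGroup V] [NormedSpace ℂ V]
    [NormedAddCommGroup W] [NormedSpace ℂ W] (g : V →ₗ[ℂ] W) (K : ℝ)
    (h : ∀ v, ‖g v‖ ≤ (K + ‖v‖) ^ 2) : Continuous g := by
  obtain ⟨M, hM⟩ := LinearMap.bound_of_ball_bound (r := 1) one_pos ((|K| + 1) ^ 2) g (by
    intro v hv
    rw [mem_ball_zero_iff] at hv
    refine (h v).trans (sq_le_sq' ?_ ?_)
    · have := neg_abs_le K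
      have := norm_nonneg v
      linarith
    · have := le_abs_self K
      linarith)
  exact (g.mkContinuous M hM).continuous

theorem continuous_leftInner (y : Y) : Continuous (E.leftInnerₗ y) :=
  continuous_of_quadratic_bound _ ‖y‖ fun v => by
    rw [add_comm ‖y‖]
    exact E.norm_leftInner_le v y

theorem continuous_rightInner (x : Y) : Continuous (E.rightInnerₗ x) :=
  continuous_of_quadratic_bound _ ‖x‖ fun v => E.norm_rightInner_le x v

/-- The left action on a fixed vector. -/
noncomputable def smulₗ (y : Y) : C →L[ℂ] Y :=
  LinearMap.mkContinuous
    { toFun := fun c => c • y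
      map_add' := fun c c' => add_smul c c' y
      map_smul' := fun t c => E.smul_assoc_left t c y } ‖y‖ fun c => by
    refine le_of_sq_le_sq (a := ‖c • y‖) ?_ (by positivity)
    rw [E.norm_sq_eq_leftInner, E.leftInner_smul_left, ← E.star_leftInner, E.leftInner_smul_left,
      mul_pow, E.norm_sq_eq_leftInner y]
    calc ‖c * star (c * E.leftInner y y)‖ ≤ ‖c‖ * ‖star (c * E.leftInner y y)‖ := norm_mul_le _ _
      _ ≤ ‖c‖ * (‖c‖ * ‖E.leftInner y y‖) := by
        rw [norm_star]
        gcongr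
        exact norm_mul_le _ _
      _ = ‖E.leftInner y y‖ * ‖c‖ ^ 2 := by ring

/-- The right action on a fixed vector. -/
noncomputable def opSmulₗ (y : Y) : D →L[ℂ] Y :=
  LinearMap.mkContinuous
    { toFun := fun d => op d • y
      map_add' := fun d d' => add_smul (op d) (op d') y
      map_smul' := fun t d => E.smul_assoc_right t d y } ‖y‖ fun d => by
    refine le_of_sq_le_sq (a := ‖op d • y‖) ?_ (by positivity)
    rw [E.norm_sq_eq_rightInner, E.rightInner_smul_right, ← E.star_rightInner,
      E.rightInner_smul_right, mul_pow, E.norm_sq_eq_rightInner y]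
    calc ‖star (E.rightInner y y * d) * d‖ ≤ ‖star (E.rightInner y y * d)‖ * ‖d‖ :=
          norm_mul_le _ _
      _ ≤ (‖E.rightInner y y‖ * ‖d‖) * ‖d‖ := by
        rw [norm_star]
        gcongr
        exact norm_mul_le _ _
      _ = ‖E.rightInner y y‖ * ‖d‖ ^ 2 := by ring

end EquivalenceBimodule

section Transfer

variable {A : StarSubalgebra ℂ C} {B : StarSubalgebra ℂ D}
  {E : EquivalenceBimodule C D Y} {X : Submodule ℂ Y}

theorem IsMoritaPair.exists_frame (h : IsMoritaPair A B E X) :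
    ∃ (n : ℕ) (x z : Fin n → X), ∑ i, E.rightInner (x i) (z i) = 1 := by
  have h1 : (1 : D) ∈ closure (Submodule.span ℂ
    {d : D | ∃ x ∈ X, ∃ y ∈ X, E.rightInner x y = d} : Set D) := by
    rw [h.closure_right]
    exact B.one_mem
  obtain ⟨s, hs, hs1⟩ := Metric.mem_closure_iff.1 h1 1 one_pos
  have hsB : s ∈ B := by
    have := subset_closure hs
    rwa [h.closure_right] at this
  have hu : IsUnit s := by
    have := (Units.oneSub (1 - s) (by rwa [dist_eq_norm] at hs1)).isUnit
    simpa using this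
  have : IsClosed (B : Set D) := h.isClosed_right
  obtain ⟨b, hb⟩ : ∃ b : B, s * b = 1 := by
    have hu' : IsUnit (⟨s, hsB⟩ : B) := (StarSubalgebra.coe_isUnit (S := B)).1 hu
    obtain ⟨b, hb⟩ := hu'.exists_right_inv
    exact ⟨b, congrArg Subtype.val hb⟩
  obtain ⟨n, f, g, hfg⟩ := Submodule.mem_span_set'.1 hs
  choose x hx z hz hxz using fun i => (g i).2
  refine ⟨n, fun i => ⟨x i, hx i⟩,
    fun i => ⟨op (b : D) • (f i • z i), h.op_smul_mem _ _ b.2 (X.smul_mem _ (hz i))⟩, ?_⟩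
  simp only [E.rightInner_smul_right, E.rightInner_smul_complex, hxz, ← Finset.sum_mul]
  rw [hfg, hb]

theorem IsMoritaPair.ext_left (_h : IsMoritaPair A B E X) {w w' : X}
    (hw : ∀ x : X, E.leftInner w x = E.leftInner w' x) : w = w' := by
  rw [← sub_eq_zero]
  apply Subtype.ext
  apply E.leftInner_self_eq_zero
  have h2 := hw (w - w')
  have h3 : E.leftInner (w - w' : X) (w - w' : X)
      = E.leftInner w (w - w' : X) - E.leftInner w' (w - w' : X) :=
    map_sub (E.leftInnerₗ ((w - w' : X) : Y)) (w : Y) (w' : Y)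
  rw [h3, h2, sub_self]

theorem IsMoritaPair.ext_right (h : IsMoritaPair A B E X) {d d' : D}
    (hd : ∀ x : X, op d • (x : Y) = op d' • (x : Y)) : d = d' := by
  obtain ⟨n, x, z, hxz⟩ := h.exists_frame
  rw [← one_mul d, ← one_mul d', ← hxz, Finset.sum_mul, Finset.sum_mul]
  refine Finset.sum_congr rfl fun i _ => ?_
  rw [← E.rightInner_smul_right, ← E.rightInner_smul_right, hd]

/-- For every bounded `A`-bimodule map `φ : C → A` there is exactly one pair `(τ, ψ)` that satisfies
the conditions of `IsTransfer`. -/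
theorem IsMoritaPair.existsUnique_transfer (h : IsMoritaPair A B E X) (φ : BimoduleMaps A) :
    ∃! p : (Y →ₗ[ℂ] X) × BimoduleMaps B, IsTransfer E φ p.1 p.2 := by
  obtain ⟨n, x, z, hxz⟩ := h.exists_frame
  have hexp : ∀ y : Y, ∑ i, E.leftInner y (x i) • (z i : Y) = y := by
    intro y
    simp only [E.leftInner_smul]
    rw [← Finset.sum_smul, ← Finset.op_sum, hxz, op_one, one_smul]
  have hφl : ∀ (a c : C), a ∈ A → (φ.1 (a * c) : C) = a * φ.1 c := fun a c ha =>
    congrArg Subtype.val (φ.2 ⟨a, ha⟩ c).1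
  have hφr : ∀ (a c : C), a ∈ A → (φ.1 (c * a) : C) = φ.1 c * a := fun a c ha =>
    congrArg Subtype.val (φ.2 ⟨a, ha⟩ c).2
  let τ : Y →ₗ[ℂ] X :=
    { toFun := fun y => ∑ i, ⟨(φ.1 (E.leftInner y (x i)) : C) • (z i : Y),
        h.smul_mem _ _ (φ.1 _).2 (z i).2⟩
      map_add' := fun y y' => by
        rw [← Finset.sum_add_distrib]
        refine Finset.sum_congr rfl fun i _ => Subtype.ext ?_
        simp [E.leftInner_add_left, add_smul]
      map_smul' := fun t y => by
        rw [RingHom.id_apply, Finset.smul_sum]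
        refine Finset.sum_congr rfl fun i _ => Subtype.ext ?_
        simp [E.leftInner_smul_complex, E.smul_assoc_left] }
  have hτ : ∀ y, (τ y : Y) = ∑ i, (φ.1 (E.leftInner y (x i)) : C) • (z i : Y) := by
    intro y
    simp [τ]
  have h3 : ∀ (y : Y) (w : X), E.leftInner (τ y) w = φ.1 (E.leftInner y w) := by
    intro y w
    rw [hτ, E.leftInner_sum]
    conv_rhs => rw [← hexp y, E.leftInner_sum, map_sum, AddSubmonoidClass.coe_finsetSum]
    refine Finset.sum_congr rfl fun i _ => ?_
    rw [E.leftInner_smul_left, E.leftInner_smul_left,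
      hφr _ _ (h.leftInner_mem _ _ (z i).2 w.2)]
  have h1 : ∀ (c : C) (w : X), (τ (c • (w : Y)) : Y) = (φ.1 c : C) • (w : Y) := by
    intro c w
    refine congrArg Subtype.val (h.ext_left (w := τ (c • (w : Y)))
      (w' := ⟨_, h.smul_mem _ _ (φ.1 c).2 w.2⟩) fun v => ?_)
    rw [h3, E.leftInner_smul_left, E.leftInner_smul_left,
      hφr _ _ (h.leftInner_mem _ _ w.2 v.2)]
  have h2 : ∀ (a : A) (y : Y), (τ ((a : C) • y) : Y) = (a : C) • (τ y : Y) := by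
    intro a y
    refine congrArg Subtype.val (h.ext_left (w := τ ((a : C) • y))
      (w' := ⟨_, h.smul_mem _ _ a.2 (τ y).2⟩) fun v => ?_)
    rw [h3, E.leftInner_smul_left, E.leftInner_smul_left, h3, hφl _ _ a.2]
  have h5 : ∀ (b : B) (y : Y), (τ (op (b : D) • y) : Y) = op (b : D) • (τ y : Y) := by
    intro b y
    refine congrArg Subtype.val (h.ext_left (w := τ (op (b : D) • y))
      (w' := ⟨_, h.op_smul_mem _ _ b.2 (τ y).2⟩) fun v => ?_)
    have := h3 y ⟨_, h.op_smul_mem _ _ (star_mem b.2) v.2⟩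
    rw [h3, E.leftInner_op_smul, E.leftInner_op_smul, this]
  let ψ₀ : D → D := fun d => ∑ i, E.rightInner (x i) (τ (op d • (z i : Y)))
  have hψ₀ : ∀ d, ψ₀ d ∈ B := fun d =>
    sum_mem fun i _ => h.rightInner_mem _ _ (x i).2 (τ _).2
  have h4 : ∀ (d : D) (w : X), (τ (op d • (w : Y)) : Y) = op (ψ₀ d) • (w : Y) := by
    intro d w
    simp only [ψ₀, Finset.op_sum, Finset.sum_smul, ← E.leftInner_smul]
    conv_lhs => rw [← hexp w, Finset.smul_sum, map_sum, AddSubmonoidClass.coe_finsetSum]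
    refine Finset.sum_congr rfl fun i _ => ?_
    rw [← E.smul_comm]
    exact h2 ⟨_, h.leftInner_mem _ _ w.2 (x i).2⟩ _
  let ψ₁ : D →ₗ[ℂ] B :=
    { toFun := fun d => ⟨ψ₀ d, hψ₀ d⟩
      map_add' := fun d d' => Subtype.ext (h.ext_right fun w => by
        change _ = op (ψ₀ d + ψ₀ d') • (w : Y)
        rw [← h4, op_add, op_add, add_smul, add_smul, ← h4, ← h4, map_add, X.coe_add])
      map_smul' := fun t d => Subtype.ext (h.ext_right fun w => by
        change _ = op (t • ψ₀ d) • (w : Y)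
        rw [← h4, E.smul_assoc_right, E.smul_assoc_right, ← h4, map_smul, X.coe_smul]) }
  have hcont : Continuous ψ₁ := by
    refine Continuous.subtype_mk (f := ψ₀) ?_ hψ₀
    refine continuous_finsetSum _ fun i _ => ?_
    refine (E.continuous_rightInner (x i)).comp ?_
    simp only [hτ]
    refine continuous_finsetSum _ fun j _ => ?_
    refine (E.smulₗ (z j : Y)).continuous.comp (continuous_subtype_val.comp
      (φ.1.continuous.comp ?_))
    exact (E.continuous_leftInner (x j)).comp (E.opSmulₗ (z i : Y)).continuous
  let ψ : BimoduleMaps B := ⟨⟨ψ₁, hcont⟩, fun b d => by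
    constructor
    · refine Subtype.ext (h.ext_right fun w => ?_)
      change op (ψ₀ (b * d)) • (w : Y) = op (b * ψ₀ d) • (w : Y)
      rw [← h4, op_mul, op_mul, mul_smul, mul_smul]
      exact h4 d ⟨_, h.op_smul_mem _ _ b.2 w.2⟩
    · refine Subtype.ext (h.ext_right fun w => ?_)
      change op (ψ₀ (d * b)) • (w : Y) = op (ψ₀ d * b) • (w : Y)
      rw [← h4, op_mul, op_mul, mul_smul, mul_smul, h5, h4]⟩
  refine ⟨(τ, ψ), ⟨h1, h2, h3, h4, h5, fun w y => h.ext_right fun v => ?_⟩, ?_⟩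
  · change op (ψ₀ _) • (v : Y) = _
    rw [← h4, ← E.leftInner_smul, ← E.leftInner_smul]
    exact h2 ⟨_, h.leftInner_mem _ _ v.2 w.2⟩ y
  · rintro ⟨τ', ψ'⟩ h'
    have hττ : τ' = τ := LinearMap.ext fun y => h.ext_left fun w => by
      rw [h'.leftInner_tau, h3]
    refine Prod.ext hττ (Subtype.ext (ContinuousLinearMap.ext fun d => Subtype.ext
      (h.ext_right fun w => ?_)))
    have := h'.tau_op_smul d w
    change op (ψ'.1 d : D) • (w : Y) = op (ψ₀ d) • (w : Y)
    rw [← this, ← h4]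
    exact congrArg (fun σ : Y →ₗ[ℂ] X => (σ (op d • (w : Y)) : Y)) hττ

/-- The map `f` from bounded `A`-bimodule maps `C → A` to bounded `B`-bimodule maps `D → B` induced
by `Y` and `X`: `transfer h φ` is the unique `ψ` which, with the unique `τ`, satisfies the
conditions of `IsTransfer`. -/
noncomputable def transfer (h : IsMoritaPair A B E X) (φ : BimoduleMaps A) : BimoduleMaps B :=
  (h.existsUnique_transfer φ).choose.2

end Transfer

end InclusionMorita

namespace InclusionMorita

open MulOpposite

section Corollary

variable {C D Y : Type*}
  [CStarAlgebra C] [PartialOrder C] [StarOrderedRing C]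
  [CStarAlgebra D] [PartialOrder D] [StarOrderedRing D]
  [NormedAddCommGroup Y] [NormedSpace ℂ Y] [CompleteSpace Y]
  [Module C Y] [Module Dᵐᵒᵖ Y]
  {A : StarSubalgebra ℂ C} {B : StarSubalgebra ℂ D}
  {E : EquivalenceBimodule C D Y} {X : Submodule ℂ Y}

/-! Elements of `D` are determined by their right action on `X`, and `τ` turns that action into data
about `φ`. Since `φ 1 = 1`, `τ` fixes `X`, so x·ψ(b) = τ(x·b) = x·b and `ψ` is the identity on `B`.
For positivity, ⟨x·ψ(d), x⟩_C = φ(⟨x·d, x⟩_C) ≥ 0 when d ≥ 0, and `IsMoritaPair.nonneg_of_leftInner`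
turns this into ψ(d) ≥ 0.

For the index, fix finite frames in `X` with ∑ ⟨x_j, z_j⟩_D = 1 and ∑ ⟨w_l, w'_l⟩_C = 1. A
quasi-basis (u_i, v_i) of `φ` gives y = ∑ u_i·τ(v_i·y) on all of `Y`. Expanding in the two frames
shows that the elements ⟨x_j, u_i·w_l⟩_D and ⟨w'_l, v_i·z_j⟩_D form a quasi-basis of `ψ`
(`IsTransfer.reconstruction`); the second quasi-basis identity follows from the first by taking
adjoints. -/

/-! ### Finite frames for the left inner product. -/

theorem IsMoritaPair.exists_left_frame (h : IsMoritaPair A B E X) :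
    ∃ (n : ℕ) (x z : Fin n → X), ∑ i, E.leftInner (x i) (z i) = 1 := by
  have h1 : (1 : C) ∈ closure (Submodule.span ℂ
    {c : C | ∃ x ∈ X, ∃ y ∈ X, E.leftInner x y = c} : Set C) := by
    rw [h.closure_left]
    exact A.one_mem
  obtain ⟨s, hs, hs1⟩ := Metric.mem_closure_iff.1 h1 1 one_pos
  have hsA : s ∈ A := by
    have := subset_closure hs
    rwa [h.closure_left] at this
  have hu : IsUnit s := by
    have := (Units.oneSub (1 - s) (by rwa [dist_eq_norm] at hs1)).isUnit
    simpa using this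
  have : IsClosed (A : Set C) := h.isClosed_left
  -- By spectral permanence, `s` is already invertible in the closed subalgebra `A`; its inverse is
  -- then absorbed into the first vectors without leaving `X`.
  obtain ⟨a, ha⟩ : ∃ a : A, a * s = 1 := by
    have hu' : IsUnit (⟨s, hsA⟩ : A) := (StarSubalgebra.coe_isUnit (S := A)).1 hu
    obtain ⟨a, ha⟩ := hu'.exists_left_inv
    exact ⟨a, congrArg Subtype.val ha⟩
  obtain ⟨n, f, g, hfg⟩ := Submodule.mem_span_set'.1 hs
  choose x hx z hz hxz using fun i => (g i).2
  refine ⟨n, fun i => ⟨(a : C) • (f i • x i), h.smul_mem _ _ a.2 (X.smul_mem _ (hx i))⟩,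
    fun i => ⟨z i, hz i⟩, ?_⟩
  simp only [E.leftInner_smul_left, E.leftInner_smul_complex, hxz, ← Finset.mul_sum]
  rw [hfg, ha]

/-! ### Adjoints and positivity. -/

/-- A positive bimodule map is star-preserving. -/
theorem IsConditionalExpectation.map_star {φ : BimoduleMaps A}
    (hφ : IsConditionalExpectation φ) (c : C) : (φ.1 (star c) : C) = star (φ.1 c : C) := by
  let p : C →ₚ[ℂ] C := PositiveLinearMap.mk₀
    (A.toSubalgebra.val.toLinearMap ∘ₗ φ.1.toLinearMap) hφ.2
  exact StarHomClass.map_star p c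

/-- Paired with y ∈ X, both x·ψ(d*) and x·ψ(d)* reduce through `τ` to φ(⟨x, y·d⟩_C), because `φ`
preserves adjoints. -/
theorem IsTransfer.map_star {φ : BimoduleMaps A} {τ : Y →ₗ[ℂ] X} {ψ : BimoduleMaps B}
    (h : IsMoritaPair A B E X) (ht : IsTransfer E φ τ ψ) (hφ : IsConditionalExpectation φ)
    (d : D) : (ψ.1 (star d) : D) = star (ψ.1 d : D) := by
  refine h.ext_right fun x => ?_
  refine congrArg Subtype.val (h.ext_left (w := ⟨_, h.op_smul_mem _ _ (ψ.1 (star d)).2 x.2⟩)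
    (w' := ⟨_, h.op_smul_mem _ _ (star_mem (ψ.1 d).2) x.2⟩) fun y => ?_)
  change E.leftInner (op (ψ.1 (star d) : D) • (x : Y)) y
    = E.leftInner (op (star (ψ.1 d : D)) • (x : Y)) y
  rw [← ht.tau_op_smul, ht.leftInner_tau, E.leftInner_op_smul, E.leftInner_op_smul, star_star,
    star_star, ← ht.tau_op_smul, ← E.star_leftInner, hφ.map_star, ← E.star_leftInner (τ _ : Y),
    ht.leftInner_tau]

theorem EquivalenceBimodule.leftInner_star_mul_self_nonneg (E : EquivalenceBimodule C D Y)
    (d : D) (y : Y) : 0 ≤ E.leftInner (op (star d * d) • y) y := by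
  rw [op_mul, mul_smul, E.leftInner_op_smul]
  exact E.leftInner_self_nonneg _

/-- A self-adjoint element of `B` that acts on `X` with non-negative quadratic form is
non-negative. -/
theorem IsMoritaPair.nonneg_of_leftInner (h : IsMoritaPair A B E X) {b : D} (hb : b ∈ B)
    (hsa : IsSelfAdjoint b) (hpos : ∀ x : X, 0 ≤ E.leftInner (op b • (x : Y)) x) : 0 ≤ b := by
  -- Functional calculus stays in the closed subalgebra `B`, so x·b⁻ lies in `X` and is a legitimate
  -- test vector.
  have hmem : b⁻ ∈ B := by
    have hn : b⁻ = cfc (fun t : ℝ => t⁻) b := by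
      rw [CFC.negPart_def, cfcₙ_eq_cfc]
    rw [hn]
    have : IsClosed (B : Set D) := h.isClosed_right
    exact cfc_mem (𝕜' := ℂ) _ hb
  have hnsa : star b⁻ = b⁻ := (CFC.negPart_nonneg b).isSelfAdjoint
  -- The quadratic form of `b` at x·b⁻ is that of b⁻bb⁻ at x. As b⁺b⁻ = 0, this is minus the cube of
  -- b⁻.
  have hcube : b⁻ * b * b⁻ = -(b⁻ * b⁻ * b⁻) := by
    have hb' : b⁻ * b = -(b⁻ * b⁻) := by
      conv_lhs => enter [2]; rw [← CFC.posPart_sub_negPart b hsa]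
      simp [mul_sub]
    rw [hb', neg_mul]
  have hnn : 0 ≤ b⁻ * b⁻ * b⁻ := by
    have := star_left_conjugate_nonneg (CFC.negPart_nonneg b) b⁻
    rwa [hnsa] at this
  obtain ⟨c, hc⟩ := CStarAlgebra.nonneg_iff_eq_star_mul_self.1 hnn
  -- With (b⁻)³ = c*c, the hypothesis at x·b⁻ reads -⟨x·c*, x·c*⟩_C ≥ 0, so c* annihilates `X`.
  have hc0 : star c = 0 := by
    refine h.ext_right fun x => ?_
    rw [op_zero, zero_smul]
    refine E.leftInner_self_eq_zero _ (le_antisymm ?_ (E.leftInner_self_nonneg _))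
    have h1 := hpos ⟨_, h.op_smul_mem _ _ hmem x.2⟩
    have h2 : E.leftInner (op b • op b⁻ • (x : Y)) (op b⁻ • (x : Y))
        = E.leftInner (op (-(b⁻ * b⁻ * b⁻)) • (x : Y)) x := by
      rw [← hcube, op_mul, op_mul, mul_smul, mul_smul, E.leftInner_op_smul b⁻ (op b • _), hnsa]
    rw [h2, hc, op_neg, neg_smul, ← neg_one_smul ℂ, E.leftInner_smul_complex, neg_one_smul,
      op_mul, mul_smul, E.leftInner_op_smul c] at h1
    exact neg_nonneg.1 h1
  have h3 : b⁻ * b⁻ * b⁻ = 0 := by rw [hc, hc0, zero_mul]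
  have h4 : b⁻ * b⁻ = 0 := by
    rw [← CStarRing.star_mul_self_eq_zero_iff, star_mul, hnsa, ← mul_assoc, h3, zero_mul]
  have h5 : b⁻ = 0 := by
    rw [← CStarRing.star_mul_self_eq_zero_iff, hnsa, h4]
  exact (CFC.negPart_eq_zero_iff b hsa).1 h5

theorem IsTransfer.isConditionalExpectation {φ : BimoduleMaps A} {τ : Y →ₗ[ℂ] X}
    {ψ : BimoduleMaps B} (h : IsMoritaPair A B E X) (ht : IsTransfer E φ τ ψ)
    (hφ : IsConditionalExpectation φ) : IsConditionalExpectation ψ := by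
  refine ⟨fun b => Subtype.ext (h.ext_right fun x => ?_), fun d hd => ?_⟩
  -- φ(1) = 1 makes `τ` the identity on `X`.
  · have h1 : (φ.1 (1 : C) : C) = 1 := congrArg Subtype.val (hφ.1 1)
    have h2 := ht.tau_smul 1 x
    rw [h1, one_smul] at h2
    rw [← ht.tau_op_smul, ht.tau_op_smul_right, h2]
  · refine h.nonneg_of_leftInner (ψ.1 d).2 ?_ fun x => ?_
    · rw [IsSelfAdjoint, ← ht.map_star h hφ, hd.isSelfAdjoint.star_eq]
    · rw [← ht.tau_op_smul, ht.leftInner_tau]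
      obtain ⟨e, rfl⟩ := CStarAlgebra.nonneg_iff_eq_star_mul_self.1 hd
      exact hφ.2 _ (E.leftInner_star_mul_self_nonneg e x)

/-! ### Transport of quasi-bases. -/

/-- A left reconstruction formula for `φ` yields one for its transfer `ψ`. -/
theorem IsTransfer.reconstruction {φ : BimoduleMaps A} {τ : Y →ₗ[ℂ] X} {ψ : BimoduleMaps B}
    (ht : IsTransfer E φ τ ψ) {m n k : ℕ} {u v : Fin m → C}
    (huv : ∀ c : C, c = ∑ i, u i * (φ.1 (v i * c) : C)) {x z : Fin n → X}
    (hxz : ∑ j, E.rightInner (x j) (z j) = 1) {w w' : Fin k → X}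
    (hw : ∑ l, E.leftInner (w l) (w' l) = 1) (d : D) :
    d = ∑ j, ∑ i, ∑ l, E.rightInner (x j) (u i • (w l : Y)) *
      (ψ.1 (E.rightInner (w' l) (v i • (z j : Y)) * d) : D) := by
  -- Apply the formula for `c` to x and use φ(v_i c)·x = τ(v_i c·x).
  have hX : ∀ (c : C) (x : X), c • (x : Y) = ∑ i, u i • (τ (v i • c • (x : Y)) : Y) := by
    intro c x
    conv_lhs => rw [huv c, Finset.sum_smul]
    refine Finset.sum_congr rfl fun i _ => ?_
    rw [mul_smul, ← ht.tau_smul, mul_smul]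
  -- The right frame writes y as ∑ ⟨y, x_j⟩_C·z_j, a sum of elements of C·X, so `hX` extends by
  -- linearity.
  have hY : ∀ y : Y, y = ∑ i, u i • (τ (v i • y) : Y) := by
    intro y
    have hexp : y = ∑ j, E.leftInner y (x j) • (z j : Y) := by
      simp only [E.leftInner_smul]
      rw [← Finset.sum_smul, ← Finset.op_sum, hxz, op_one, one_smul]
    conv_lhs => rw [hexp]
    conv_rhs => rw [hexp]
    simp only [Finset.smul_sum, map_sum, AddSubmonoidClass.coe_finsetSum]
    rw [Finset.sum_comm]
    exact Finset.sum_congr rfl fun j _ => hX _ _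
  -- The left frame expands y as ∑ w_l·⟨w'_l, y⟩_D, which brings `τ` back to `ψ`.
  have hτ : ∀ y : Y, (τ (op d • y) : Y)
      = ∑ l, op (ψ.1 (E.rightInner (w' l) y * d) : D) • (w l : Y) := by
    intro y
    have hexp : y = ∑ l, op (E.rightInner (w' l) y) • (w l : Y) := by
      simp only [← E.leftInner_smul]
      rw [← Finset.sum_smul, hw, one_smul]
    conv_lhs => rw [hexp]
    simp only [Finset.smul_sum, map_sum, AddSubmonoidClass.coe_finsetSum]
    refine Finset.sum_congr rfl fun l _ => ?_
    rw [← mul_smul, ← op_mul, ht.tau_op_smul]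
  have hsum : ∀ (y : Y) {r : ℕ} (g : Fin r → Y),
      E.rightInner y (∑ i, g i) = ∑ i, E.rightInner y (g i) :=
    fun y _ g => map_sum (E.rightInnerₗ y) g _
  conv_lhs => rw [← one_mul d, ← hxz, Finset.sum_mul]
  refine Finset.sum_congr rfl fun j _ => ?_
  rw [← E.rightInner_smul_right, hY (op d • (z j : Y)), hsum]
  refine Finset.sum_congr rfl fun i _ => ?_
  rw [E.smul_comm, hτ, Finset.smul_sum, hsum]
  refine Finset.sum_congr rfl fun l _ => ?_
  rw [E.smul_comm, E.rightInner_smul_right]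

theorem IsTransfer.isIndexFinite {φ : BimoduleMaps A} {τ : Y →ₗ[ℂ] X}
    {ψ : BimoduleMaps B} (h : IsMoritaPair A B E X) (ht : IsTransfer E φ τ ψ)
    (hφ : IsConditionalExpectation φ) (hφ' : IsIndexFinite φ) : IsIndexFinite ψ := by
  obtain ⟨m, u, v, huv⟩ := hφ'
  obtain ⟨n, x, z, hxz⟩ := h.exists_frame
  obtain ⟨k, w, w', hw⟩ := h.exists_left_frame
  have hzx : ∑ j, E.rightInner (z j) (x j) = 1 := by
    simpa [E.star_rightInner] using congrArg star hxz
  have hw' : ∑ l, E.leftInner (w' l) (w l) = 1 := by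
    simpa [E.star_leftInner] using congrArg star hw
  -- The adjoint of the second identity for `φ` is a left formula for the pairs (v_i*, u_i*).
  have huv' : ∀ c : C, c = ∑ i, star (v i) * (φ.1 (star (u i) * c) : C) := by
    intro c
    have := congrArg star (huv (star c)).2
    simpa [← hφ.map_star] using this
  let e := Fintype.equivFin (Fin n × Fin m × Fin k)
  let U : Fin n × Fin m × Fin k → D := fun p => E.rightInner (x p.1) (u p.2.1 • (w p.2.2 : Y))
  let V : Fin n × Fin m × Fin k → D := fun p => E.rightInner (w' p.2.2) (v p.2.1 • (z p.1 : Y))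
  refine ⟨_, U ∘ e.symm, V ∘ e.symm, fun d => ⟨?_, ?_⟩⟩
  · refine Eq.trans ?_ (e.symm.sum_comp fun p => U p * (ψ.1 (V p * d) : D)).symm
    simp only [Fintype.sum_prod_type]
    exact ht.reconstruction (fun c => (huv c).1) hxz hw d
  · refine Eq.trans ?_ (e.symm.sum_comp fun p => (ψ.1 (d * U p) : D) * V p).symm
    simp only [Fintype.sum_prod_type]
    -- Reversing both frames along with the pairs makes the adjoint of this formula use exactly the
    -- same `U` and `V`, in the other order.
    have := congrArg star (ht.reconstruction huv' hzx hw' (star d))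
    simpa [← ht.map_star h hφ, ← E.rightInner_smul, E.star_rightInner, U, V] using this

end Corollary

end InclusionMorita

theorem corollary3p9 {C D Y : Type*}
    [CStarAlgebra C] [PartialOrder C] [StarOrderedRing C]
    [CStarAlgebra D] [PartialOrder D] [StarOrderedRing D]
    [NormedAddCommGroup Y] [NormedSpace ℂ Y] [CompleteSpace Y]
    [Module C Y] [Module Dᵐᵒᵖ Y]
    (A : StarSubalgebra ℂ C) (B : StarSubalgebra ℂ D)
    (E : InclusionMorita.EquivalenceBimodule C D Y) (X : Submodule ℂ Y)
    (h : InclusionMorita.IsMoritaPair A B E X)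
    (φ : InclusionMorita.BimoduleMaps A)
    (hφ : InclusionMorita.IsConditionalExpectation φ) (hφ' : InclusionMorita.IsIndexFinite φ) :
    InclusionMorita.IsConditionalExpectation (InclusionMorita.transfer h φ) ∧
      InclusionMorita.IsIndexFinite (InclusionMorita.transfer h φ) := by
  -- `transfer h φ` is by definition the second component of this chosen pair.
  have ht := (h.existsUnique_transfer φ).choose_spec.1
  exact ⟨ht.isConditionalExpectation h hφ, ht.isIndexFinite h hφ hφ'⟩
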